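/- For an abelian group $G$ (written multiplicatively, with unit $1$), order $G$ discretely and add a new least element $\bot$ and a new greatest element $\top$. The resulting lattice $G\cup\{\bot,\top\}$ carries the product extending that of $G$ by $a\cdot\top=\top\cdot a=\top$ for $a\in G\cup\{\top\}$ and $b\cdot\bot=\bot\cdot b=\bot$ for all $b\in G\cup\{\bot,\top\}$, the residual $a\to c=\max\{b : a\cdot b\le c\}$, the constants $1$, $0:=1$, $\bot$, $\top$, and the unary operation $!a:=a\wedge 1$. For $S\subseteq\{0,\bot,\top,!\}$ let $R^S(G)$ be the reduct of this algebra to the operations $\{\wedge,\vee,\cdot,\to,1\}\cup S$. For a set $P$ of primes, let $\mathsf K_P^S$ be the class of all algebras with operations $\{\wedge,\vee,\cdot,\to,1\}\cup S$ that are either trivial (one-element) or isomorphic to $R^S(G)$ for some abelian group $G$ such that, for all $p\in P$ and $x\in G$, $x^p=1$ implies $x=1$. Let $\mathsf V_P^S=\mathbb{HSP}(\mathsf K_P^S)$ be the variety generated by $\mathsf K_P^S$. **Theorem.** For every nonempty set $P$ of prime numbers and every $S\subseteq\{0,\bot,\top,!\}$, the variety $\mathsf V_P^S$ has the amalgamation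 property: for all $A,B,C\in\mathsf V_P^S$ and all embeddings $\varphi_1\colon A\to B$ and $\varphi_2\colon A\to C$ there are $D\in\mathsf V_P^S$ and embeddings $\psi_1\colon B\to D$ and $\psi_2\colon C\to D$ with $\psi_1\circ\varphi_1=\psi_2\circ\varphi_2$. -/

import Mathlib

open scoped FirstOrder
open CategoryTheory (Bundled)

universe u w

namespace ResiduatedAmalgamation

/-! ### Varieties of algebras -/

section Varieties

variable {L : FirstOrder.Language.{0, 0}}

/-- The direct product of a family of algebras, with the pointwise operations. -/
instance productStructure {ι : Type u} (M : ι → Type w) [∀ i, L.Structure (M i)] :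
    L.Structure (∀ i, M i) where
  funMap f x := fun i => FirstOrder.Language.Structure.funMap f fun j => x j i
  RelMap r x := ∀ i, FirstOrder.Language.Structure.RelMap r fun j => x j i

/-- The class of algebras isomorphic to a direct product of a family of members of `K`
(the empty family, with a trivial algebra as product, is allowed). -/
def products (K : Set (Bundled.{u} L.Structure)) : Set (Bundled.{u} L.Structure) :=
  {A | ∃ (ι : Type u) (B : ι → Bundled.{u} L.Structure),
    (∀ i, B i ∈ K) ∧ Nonempty (A ≃[L] (∀ i, B i))}

/-- The class of algebras isomorphic to a subalgebra of a member of `K`. -/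
def subalgebras (K : Set (Bundled.{u} L.Structure)) : Set (Bundled.{u} L.Structure) :=
  {A | ∃ B ∈ K, ∃ C : L.Substructure B, Nonempty (A ≃[L] C)}

/-- The class of homomorphic images of members of `K`. -/
def homImages (K : Set (Bundled.{u} L.Structure)) : Set (Bundled.{u} L.Structure) :=
  {A | ∃ B ∈ K, ∃ f : B →[L] A, Function.Surjective f}

/-- The variety `HSP(K)` generated by a class `K` of algebras in an algebraic language. -/
def generatedVariety (K : Set (Bundled.{u} L.Structure)) : Set (Bundled.{u} L.Structure) :=
  homImages (subalgebras (products K))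

end Varieties

/-! ### The languages -/

/-- The optional operation symbols: the constants `0`, `⊥`, `⊤` and the unary `!`. -/
inductive OptSymbol : Type
  | zero
  | bot
  | top
  | bang

/-- The operation symbols `∧, ∨, ·, →, 1` together with those in `S`, indexed by their arity. -/
inductive OpSymbol (S : Set OptSymbol) : ℕ → Type
  | meet : OpSymbol S 2
  | join : OpSymbol S 2
  | mul : OpSymbol S 2
  | imp : OpSymbol S 2
  | one : OpSymbol S 0
  | zero (h : OptSymbol.zero ∈ S) : OpSymbol S 0
  | bot (h : OptSymbol.bot ∈ S) : OpSymbol S 0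
  | top (h : OptSymbol.top ∈ S) : OpSymbol S 0
  | bang (h : OptSymbol.bang ∈ S) : OpSymbol S 1

/-- The algebraic language with operation symbols `{∧, ∨, ·, →, 1} ∪ S`. -/
abbrev opLanguage (S : Set OptSymbol) : FirstOrder.Language.{0, 0} where
  Functions := OpSymbol S
  Relations := fun _ => Empty

/-! ### The algebra of an abelian group -/

/-- The set `G ∪ {⊥, ⊤}`, for two new elements `⊥` and `⊤`. -/
inductive Ext (G : Type u) : Type u
  | bot : Ext G
  | of : G → Ext G
  | top : Ext G

namespace Ext

variable {G : Type u}

/-- The discrete order on `G`, with a new least element and a new greatest element. -/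
instance : LE (Ext G) where
  le a b := a = bot ∨ b = top ∨ a = b

open Classical in
/-- Binary meets for the order of `Ext G`. -/
noncomputable def meet : Ext G → Ext G → Ext G
  | top, b => b
  | a, top => a
  | of a, of b => if a = b then of a else bot
  | _, _ => bot

open Classical in
/-- Binary joins for the order of `Ext G`. -/
noncomputable def join : Ext G → Ext G → Ext G
  | bot, b => b
  | a, bot => a
  | of a, of b => if a = b then of a else top
  | _, _ => top

theorem le_def (a b : Ext G) : a ≤ b ↔ a = bot ∨ b = top ∨ a = b := Iff.rfl

noncomputable instance : Lattice (Ext G) where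
  le a b := a ≤ b
  le_refl a := by simp [le_def]
  le_trans a b c := by cases a <;> cases b <;> cases c <;> simp_all [le_def]
  le_antisymm a b := by cases a <;> cases b <;> simp_all [le_def]
  inf := meet
  sup := join
  inf_le_left a b := by
    cases a <;> cases b <;> simp only [meet, le_def] <;> (try split) <;> simp_all
  inf_le_right a b := by
    cases a <;> cases b <;> simp only [meet, le_def] <;> (try split) <;> simp_all
  le_inf a b c := by
    cases a <;> cases b <;> cases c <;> simp only [meet, le_def] <;> (try split) <;> aesop
  le_sup_left a b := by
    cases a <;> cases b <;> simp only [join, le_def] <;> (try split) <;> simp_all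
  le_sup_right a b := by
    cases a <;> cases b <;> simp only [join, le_def] <;> (try split) <;> simp_all
  sup_le a b c := by
    cases a <;> cases b <;> cases c <;> simp only [join, le_def] <;> (try split) <;> aesop

/-- The product of `G`, extended by letting `⊥` absorb every element and `⊤` absorb
every element other than `⊥`. -/
def mul [Mul G] : Ext G → Ext G → Ext G
  | bot, _ => bot
  | _, bot => bot
  | top, _ => top
  | _, top => top
  | of a, of b => of (a * b)

instance [CommGroup G] : CommMonoid (Ext G) where
  mul := mul
  one := of 1
  mul_assoc a b c := by
    change mul (mul a b) c = mul a (mul b c)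
    cases a <;> cases b <;> cases c <;> simp [mul, mul_assoc]
  one_mul a := by
    change mul (of 1) a = a
    cases a <;> simp [mul]
  mul_one a := by
    change mul a (of 1) = a
    cases a <;> simp [mul]
  mul_comm a b := by
    change mul a b = mul b a
    cases a <;> cases b <;> simp [mul, mul_comm]

/-- The residual of the product of `Ext G`; see `imp_isGreatest`. -/
def imp [CommGroup G] : Ext G → Ext G → Ext G
  | bot, _ => top
  | _, top => top
  | top, _ => bot
  | of _, bot => bot
  | of a, of c => of (a⁻¹ * c)

/-- The residual satisfies `a → c = max {b | a * b ≤ c}`. -/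
theorem imp_isGreatest [CommGroup G] (a c : Ext G) :
    IsGreatest {b : Ext G | a * b ≤ c} (imp a c) := by
  constructor
  · change mul a (imp a c) ≤ c
    cases a <;> cases c <;> simp [mul, imp, le_def]
  · intro b hb
    change mul a b ≤ c at hb
    cases a <;> cases b <;> cases c <;> simp_all [mul, imp, le_def, eq_inv_mul_iff_mul_eq]

/-- The algebra obtained from the abelian group `G`, in the language `{∧, ∨, ·, →, 1} ∪ S`:
the constant `0` denotes the unit `1`, and `!a = a ∧ 1`. -/
noncomputable instance algebra (S : Set OptSymbol) (G : Type u) [CommGroup G] :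
    (opLanguage S).Structure (Ext G) where
  funMap {n} f :=
    match n, f with
    | _, OpSymbol.meet => fun x => x 0 ⊓ x 1
    | _, OpSymbol.join => fun x => x 0 ⊔ x 1
    | _, OpSymbol.mul => fun x => x 0 * x 1
    | _, OpSymbol.imp => fun x => imp (x 0) (x 1)
    | _, OpSymbol.one => fun _ => 1
    | _, OpSymbol.zero _ => fun _ => 1
    | _, OpSymbol.bot _ => fun _ => bot
    | _, OpSymbol.top _ => fun _ => top
    | _, OpSymbol.bang _ => fun x => x 0 ⊓ 1
  RelMap r := Empty.elim r

end Ext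

/-! ### The varieties -/

/-- The quasi-equations `x ^ p = 1 → x = 1` for all `p ∈ P`. -/
def NoTorsion (P : Set ℕ) (G : Type u) [CommGroup G] : Prop :=
  ∀ p ∈ P, ∀ x : G, x ^ p = 1 → x = 1

/-- The class of the trivial (one-element) algebras and of the algebras isomorphic to `Ext G`
for an abelian group `G` without `p`-torsion for `p ∈ P`. -/
def generators (P : Set ℕ) (S : Set OptSymbol) : Set (Bundled.{u} (opLanguage S).Structure) :=
  {A | (∃ (G : Type u) (_ : CommGroup G), NoTorsion P G ∧ Nonempty (A ≃[opLanguage S] Ext G)) ∨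
    Nonempty (Unique A)}

/-- The variety generated by the algebras of the abelian groups without `p`-torsion
for `p ∈ P`. -/
def groupVariety (P : Set ℕ) (S : Set OptSymbol) : Set (Bundled.{u} (opLanguage S).Structure) :=
  generatedVariety (generators P S)

end ResiduatedAmalgamation

/-!
The algebra `Ext G` of an abelian group has a term operation, `eqv x y = (x → y) ∧ (y → x) ∧ 1`,
that takes the value `1` if `x = y` and `⊥` otherwise, so that statements about finitely many
equalities become statements about single elements with all components in `{1, ⊥}`. This makes it
possible to work with ultrafilters instead of congruences.

Let `π i : A → Ext (G i)` be a jointly injective family of homomorphisms and let `f` be a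
homomorphism on `A` with `f b ≠ f b'`. For the elements `e` of `A` that are congruent to `1` modulo
the kernel of `f` and have components in `{1, ⊥}`, the sets `{i | π i e = 1}` generate a proper
filter, even after restriction to the indices where `b` and `b'` differ: if `π i b = π i b'` held
wherever `π i e = 1`, then `e * b = e * b'`, whence `f b = f b'`. An ultrafilter `U` refining this
filter contains the equalizers of all pairs identified by `f` but not that of `b` and `b'` (`exists_ultrafilter`). The
ultraproduct of the `Ext (G i)` along `U` is again the algebra of a group (`limHom`), and there is
no new torsion. Two consequences follow.

* Separation of points by homomorphisms into algebras of groups is inherited by homomorphic images,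
  so every member of the variety embeds into a product of such algebras
  (`separated_of_mem_groupVariety`).
* If `A` is a subalgebra of `C`, a homomorphism `h` from `A` into the algebra of a group that is not
  constant has the same kernel as the restriction to `A` of some homomorphism from `C` into the
  algebra of a group, because the image of `h` is simple.

Given embeddings of `A` into `B` and `C` and two points of `B`, take a homomorphism from `B` into
some `Ext G` that separates the points. If its restriction to `A` is constant, then neither `⊥` nor
`⊤` is in the signature and the restriction extends to `C` as a constant. Otherwise some
homomorphism from `C` into some `Ext K` has the same kernel on `A`, and it remains to amalgamate the
groups `G` and `K`: their pushout is divided by its torsion for products of members of `P`, which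
meets `G` and `K` trivially (`exists_group_amalgam`). The amalgam of `B` and `C` is the product of
the algebras obtained in this way for all pairs of distinct points of `B` and of `C`.
-/

namespace ResiduatedAmalgamation

open FirstOrder.Language (Structure)
open Filter

variable {S : Set OptSymbol}

/-! ### Operations and homomorphisms -/

/-- The binary operation named by a binary symbol. -/
def binOp {A : Type u} [(opLanguage S).Structure A] (f : OpSymbol S 2) (x y : A) : A :=
  Structure.funMap (L := opLanguage S) f ![x, y]

/-- The constant named by the symbol `1`. -/
def unit (S : Set OptSymbol) (A : Type u) [(opLanguage S).Structure A] : A :=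
  Structure.funMap (L := opLanguage S) OpSymbol.one ![]

/-- The term operation `(x → y) ∧ (y → x) ∧ 1`, which on the algebra of a group takes the value
`1` if `x = y` and `⊥` otherwise; see `Ext.eqv_apply`. -/
def eqv (S : Set OptSymbol) {A : Type u} [(opLanguage S).Structure A] (x y : A) : A :=
  binOp (S := S) .meet (binOp (S := S) .meet (binOp (S := S) .imp x y)
    (binOp (S := S) .imp y x)) (unit S A)

section Hom

variable {A B : Type u} [(opLanguage S).Structure A] [(opLanguage S).Structure B]

theorem map_binOp (h : A →[opLanguage S] B) (f : OpSymbol S 2) (x y : A) :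
    h (binOp f x y) = binOp f (h x) (h y) := by
  rw [binOp, h.map_fun, binOp]
  congr 1
  ext i
  fin_cases i <;> rfl

theorem map_unit (h : A →[opLanguage S] B) : h (unit S A) = unit S B := by
  rw [unit, h.map_fun, unit]
  congr 1
  ext i
  exact i.elim0

theorem map_eqv (h : A →[opLanguage S] B) (x y : A) : h (eqv S x y) = eqv S (h x) (h y) := by
  simp only [eqv, map_binOp, map_unit]

end Hom

namespace Ext

variable {G H : Type u}

theorem inf_def (x y : Ext G) : x ⊓ y = meet x y := rfl

section Operations

variable [CommGroup G]

theorem unit_eq : unit S (Ext G) = 1 := rfl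

theorem one_def : (1 : Ext G) = of 1 := rfl

theorem binOp_mul (x y : Ext G) : binOp (S := S) .mul x y = x * y := rfl

theorem bot_ne_one : (bot : Ext G) ≠ 1 := nofun

theorem top_ne_one : (top : Ext G) ≠ 1 := nofun

theorem bot_mul (x : Ext G) : bot * x = bot := rfl

open Classical in
theorem eqv_apply (x y : Ext G) : eqv S x y = if x = y then 1 else bot := by
  change (imp x y ⊓ imp y x) ⊓ 1 = _
  rw [one_def, inf_def, inf_def]
  cases x with
  | bot => cases y <;> simp [imp, meet]
  | top => cases y <;> simp [imp, meet]
  | of a =>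
    cases y with
    | bot => simp [imp, meet]
    | top => simp [imp, meet]
    | of b =>
      by_cases hab : a = b
      · subst hab; simp [imp, meet]
      · have h1 : a⁻¹ * b ≠ 1 := fun h => hab (inv_mul_eq_one.mp h)
        simp only [imp, meet, of.injEq, hab, if_false]
        split_ifs with h2
        · simp [h1]
        · rfl

theorem eqv_self (x : Ext G) : eqv S x x = 1 := by simp [eqv_apply]

theorem eqv_of_ne {x y : Ext G} (h : x ≠ y) : eqv S x y = bot := by simp [eqv_apply, h]

end Operations

/-- The extension of a map of groups that fixes `⊥` and `⊤`. -/
def map (φ : G → H) : Ext G → Ext H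
  | bot => bot
  | of g => of (φ g)
  | top => top

theorem map_injective {φ : G → H} (hφ : Function.Injective φ) : Function.Injective (map φ) := by
  intro x y h
  cases x <;> cases y <;> simp_all [map, hφ.eq_iff]

variable [CommGroup G] [CommGroup H]

/-- The homomorphism of algebras induced by an injective homomorphism of groups. Injectivity is
needed for meets and joins of distinct group elements to be preserved. -/
def mapHom (S : Set OptSymbol) (φ : G →* H) (hφ : Function.Injective φ) :
    Ext G →[opLanguage S] Ext H where
  toFun := map φ
  map_fun' := by
    intro n f x
    cases f with
    | meet =>
      change map φ (meet (x 0) (x 1)) = meet (map φ (x 0)) (map φ (x 1))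
      generalize x 0 = a
      generalize x 1 = b
      cases a <;> cases b <;> simp only [meet, map]
      split_ifs <;> simp_all [hφ.eq_iff]
    | join =>
      change map φ (join (x 0) (x 1)) = join (map φ (x 0)) (map φ (x 1))
      generalize x 0 = a
      generalize x 1 = b
      cases a <;> cases b <;> simp only [join, map]
      split_ifs <;> simp_all [hφ.eq_iff]
    | mul =>
      change map φ (mul (x 0) (x 1)) = mul (map φ (x 0)) (map φ (x 1))
      generalize x 0 = a
      generalize x 1 = b
      cases a <;> cases b <;> simp [mul, map]
    | imp =>
      change map φ (imp (x 0) (x 1)) = imp (map φ (x 0)) (map φ (x 1))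
      generalize x 0 = a
      generalize x 1 = b
      cases a <;> cases b <;> simp [imp, map]
    | one => exact congrArg of φ.map_one
    | zero => exact congrArg of φ.map_one
    | bot => rfl
    | top => rfl
    | bang =>
      change map φ (meet (x 0) (of 1)) = meet (map φ (x 0)) (of 1)
      cases x 0 with
      | bot => rfl
      | top => exact congrArg of φ.map_one
      | of g => by_cases hg : g = 1 <;> simp [meet, map, map_eq_one_iff φ hφ, hg]
  map_rel' := fun r => Empty.elim r

/-- The constant map with value `1` is a homomorphism if the signature names neither `⊥`
nor `⊤`. -/
def constHom {A : Type u} [(opLanguage S).Structure A] (hbot : OptSymbol.bot ∉ S)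
    (htop : OptSymbol.top ∉ S) : A →[opLanguage S] Ext G where
  toFun _ := 1
  map_fun' := by
    intro n f x
    cases f with
    | meet => exact (inf_idem (1 : Ext G)).symm
    | join => exact (sup_idem (1 : Ext G)).symm
    | mul => exact (mul_one (1 : Ext G)).symm
    | imp => exact congrArg of (by simp)
    | one => rfl
    | zero => rfl
    | bot h => exact absurd h hbot
    | top h => exact absurd h htop
    | bang => exact (inf_idem (1 : Ext G)).symm
  map_rel' := fun r => Empty.elim r

end Ext

/-! ### Ultraproducts of algebras of groups -/

section Ultraproduct

variable {ι : Type u} (U : Ultrafilter ι) (G : ι → Type u) [∀ i, CommGroup (G i)]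

/-- The families that are equal to `1` almost everywhere for the ultrafilter `U`. -/
def nullSubgroup : Subgroup (∀ i, G i) where
  carrier := {x | ∀ᶠ i in U, x i = 1}
  one_mem' := Eventually.of_forall fun _ => rfl
  mul_mem' hx hy := by
    filter_upwards [hx, hy] with i h1 h2
    simp [h1, h2]
  inv_mem' hx := by
    filter_upwards [hx] with i h1
    simp [h1]

/-- The ultraproduct of a family of groups. -/
abbrev GroupUltraproduct : Type u := (∀ i, G i) ⧸ nullSubgroup U G

variable {G}

theorem mem_nullSubgroup {x : ∀ i, G i} : x ∈ nullSubgroup U G ↔ ∀ᶠ i in U, x i = 1 := Iff.rfl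

theorem mk_eq_mk_iff {x y : ∀ i, G i} :
    (x : GroupUltraproduct U G) = y ↔ ∀ᶠ i in U, x i = y i := by
  rw [QuotientGroup.eq, mem_nullSubgroup]
  simp [inv_mul_eq_one]

theorem noTorsion_groupUltraproduct {P : Set ℕ} (hG : ∀ i, NoTorsion P (G i)) :
    NoTorsion P (GroupUltraproduct U G) := by
  intro p hp x
  induction x using QuotientGroup.induction_on with | _ x
  rw [← QuotientGroup.mk_pow, QuotientGroup.eq_one_iff, QuotientGroup.eq_one_iff,
    mem_nullSubgroup, mem_nullSubgroup]
  intro h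
  filter_upwards [h] with i hi
  exact hG i p hp _ hi

/-- The element `t` is the limit of the family `x`: for a representative `s` of `t`, almost all
entries of `x` are the corresponding entries of `s`. -/
def IsLimit (x : ∀ i, Ext (G i)) (t : Ext (GroupUltraproduct U G)) : Prop :=
  ∃ s : Ext (∀ i, G i), s.map (QuotientGroup.mk (s := nullSubgroup U G)) = t ∧
    ∀ᶠ i in U, x i = s.map fun g => g i

variable {U}

theorem exists_isLimit (x : ∀ i, Ext (G i)) : ∃ t, IsLimit U x t := by
  rcases U.em fun i => x i = .bot with h | hbot
  · exact ⟨_, .bot, rfl, h⟩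
  rcases U.em fun i => x i = .top with h | htop
  · exact ⟨_, .top, rfl, h⟩
  have h : ∀ i, ∃ g : G i, x i ≠ .bot → x i ≠ .top → x i = .of g := by
    intro i
    cases hx : x i with
    | bot => exact ⟨1, by simp⟩
    | top => exact ⟨1, by simp⟩
    | of g => exact ⟨g, fun _ _ => rfl⟩
  choose g hg using h
  refine ⟨_, .of g, rfl, ?_⟩
  filter_upwards [hbot, htop] with i h1 h2 using hg i h1 h2

theorem IsLimit.eq_iff {x y : ∀ i, Ext (G i)} {s t : Ext (GroupUltraproduct U G)}
    (hx : IsLimit U x s) (hy : IsLimit U y t) : s = t ↔ ∀ᶠ i in U, x i = y i := by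
  obtain ⟨a, rfl, ha⟩ := hx
  obtain ⟨b, rfl, hb⟩ := hy
  have key : (∀ᶠ i in U, x i = y i) ↔
      ∀ᶠ i in U, a.map (fun g => g i) = b.map fun g => g i := by
    constructor
    · intro h
      filter_upwards [ha, hb, h] with i h1 h2 h3
      rw [← h1, ← h2, h3]
    · intro h
      filter_upwards [ha, hb, h] with i h1 h2 h3
      rw [h1, h2, h3]
  rw [key]
  cases a <;> cases b <;> simp [Ext.map, mk_eq_mk_iff, U.neBot.ne]

/-- To check that limits commute with a binary operation it suffices to consider families of
entries `a.map fun g => g i` and `b.map fun g => g i` of fixed representatives `a` and `b`. -/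
theorem IsLimit.binary {x y : ∀ i, Ext (G i)} {s t : Ext (GroupUltraproduct U G)}
    (hx : IsLimit U x s) (hy : IsLimit U y t)
    (op : ∀ {K : Type u} [CommGroup K], Ext K → Ext K → Ext K)
    (hop : ∀ a b : Ext (∀ i, G i), ∃ c : Ext (∀ i, G i),
      c.map (QuotientGroup.mk (s := nullSubgroup U G)) =
        op (a.map QuotientGroup.mk) (b.map QuotientGroup.mk) ∧
      ∀ᶠ i in U, op (a.map fun g => g i) (b.map fun g => g i) = c.map fun g => g i) :
    IsLimit U (fun i => op (x i) (y i)) (op s t) := by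
  obtain ⟨a, rfl, ha⟩ := hx
  obtain ⟨b, rfl, hb⟩ := hy
  obtain ⟨c, hc, hc'⟩ := hop a b
  refine ⟨c, hc, ?_⟩
  filter_upwards [ha, hb, hc'] with i h1 h2 h3
  rw [h1, h2, h3]

section Operations

variable {x y : ∀ i, Ext (G i)} {s t : Ext (GroupUltraproduct U G)}

theorem IsLimit.inf (hx : IsLimit U x s) (hy : IsLimit U y t) :
    IsLimit U (fun i => x i ⊓ y i) (s ⊓ t) := by
  refine hx.binary hy (fun a b => Ext.meet a b) fun a b => ?_
  rcases a with _ | a | _ <;> rcases b with _ | b | _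
  case of.of =>
    rcases U.em fun i => a i = b i with h | h
    · refine ⟨.of a, ?_, ?_⟩
      · simp [Ext.map, Ext.meet, (mk_eq_mk_iff U).2 h]
      · filter_upwards [h] with i hi
        simp [Ext.map, Ext.meet, hi]
    · refine ⟨.bot, ?_, ?_⟩
      · have : (a : GroupUltraproduct U G) ≠ b := fun h' =>
          Ultrafilter.eventually_not.1 h ((mk_eq_mk_iff U).1 h')
        simp [Ext.map, Ext.meet, this]
      · filter_upwards [h] with i hi
        simp [Ext.map, Ext.meet, hi]
  all_goals first
    | exact ⟨.bot, rfl, Eventually.of_forall fun _ => rfl⟩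
    | exact ⟨.top, rfl, Eventually.of_forall fun _ => rfl⟩
    | exact ⟨.of a, rfl, Eventually.of_forall fun _ => rfl⟩
    | exact ⟨.of b, rfl, Eventually.of_forall fun _ => rfl⟩

theorem IsLimit.sup (hx : IsLimit U x s) (hy : IsLimit U y t) :
    IsLimit U (fun i => x i ⊔ y i) (s ⊔ t) := by
  refine hx.binary hy (fun a b => Ext.join a b) fun a b => ?_
  rcases a with _ | a | _ <;> rcases b with _ | b | _
  case of.of =>
    rcases U.em fun i => a i = b i with h | h
    · refine ⟨.of a, ?_, ?_⟩
      · simp [Ext.map, Ext.join, (mk_eq_mk_iff U).2 h]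
      · filter_upwards [h] with i hi
        simp [Ext.map, Ext.join, hi]
    · refine ⟨.top, ?_, ?_⟩
      · have : (a : GroupUltraproduct U G) ≠ b := fun h' =>
          Ultrafilter.eventually_not.1 h ((mk_eq_mk_iff U).1 h')
        simp [Ext.map, Ext.join, this]
      · filter_upwards [h] with i hi
        simp [Ext.map, Ext.join, hi]
  all_goals first
    | exact ⟨.bot, rfl, Eventually.of_forall fun _ => rfl⟩
    | exact ⟨.top, rfl, Eventually.of_forall fun _ => rfl⟩
    | exact ⟨.of a, rfl, Eventually.of_forall fun _ => rfl⟩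
    | exact ⟨.of b, rfl, Eventually.of_forall fun _ => rfl⟩

theorem IsLimit.mul (hx : IsLimit U x s) (hy : IsLimit U y t) :
    IsLimit U (fun i => x i * y i) (s * t) := by
  refine hx.binary hy (fun a b => Ext.mul a b) fun a b => ⟨Ext.mul a b, ?_, ?_⟩
  · cases a <;> cases b <;> rfl
  · cases a <;> cases b <;> exact Eventually.of_forall fun _ => rfl

theorem IsLimit.imp (hx : IsLimit U x s) (hy : IsLimit U y t) :
    IsLimit U (fun i => Ext.imp (x i) (y i)) (Ext.imp s t) := by
  refine hx.binary hy (fun a b => Ext.imp a b) fun a b => ⟨Ext.imp a b, ?_, ?_⟩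
  · cases a <;> cases b <;> rfl
  · cases a <;> cases b <;> exact Eventually.of_forall fun _ => rfl

theorem isLimit_one : IsLimit U (fun i => (1 : Ext (G i))) 1 :=
  ⟨.of 1, rfl, Eventually.of_forall fun _ => rfl⟩

end Operations

/-- The limit of a family of elements along the ultrafilter `U`, as a homomorphism. It identifies
the ultraproduct of the algebras `Ext (G i)` with the algebra of the ultraproduct of the
groups `G i`. -/
noncomputable def limHom (S : Set OptSymbol) (U : Ultrafilter ι) (G : ι → Type u)
    [∀ i, CommGroup (G i)] : (∀ i, Ext (G i)) →[opLanguage S] Ext (GroupUltraproduct U G) where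
  toFun x := (exists_isLimit x).choose
  map_fun' := by
    have hl (x : ∀ i, Ext (G i)) : IsLimit U x (exists_isLimit x).choose :=
      (exists_isLimit x).choose_spec
    have uniq {x : ∀ i, Ext (G i)} {t} (h : IsLimit U x t) : (exists_isLimit x).choose = t :=
      ((hl x).eq_iff h).2 (Eventually.of_forall fun _ => rfl)
    intro n f x
    apply uniq
    cases f with
    | meet => exact (hl _).inf (hl _)
    | join => exact (hl _).sup (hl _)
    | mul => exact (hl _).mul (hl _)
    | imp => exact (hl _).imp (hl _)
    | one => exact isLimit_one
    | zero => exact isLimit_one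
    | bot => exact ⟨.bot, rfl, Eventually.of_forall fun _ => rfl⟩
    | top => exact ⟨.top, rfl, Eventually.of_forall fun _ => rfl⟩
    | bang => exact (hl _).inf isLimit_one
  map_rel' := fun r => Empty.elim r

theorem limHom_eq_iff {x y : ∀ i, Ext (G i)} :
    limHom S U G x = limHom S U G y ↔ ∀ᶠ i in U, x i = y i :=
  (exists_isLimit x).choose_spec.eq_iff (exists_isLimit y).choose_spec

end Ultraproduct

/-! ### Families of homomorphisms into algebras of groups -/

/-- The homomorphism into a product with given components. -/
def piHom {L : FirstOrder.Language.{0, 0}} {A : Type u} [L.Structure A] {ι : Type u}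
    {M : ι → Type u} [∀ i, L.Structure (M i)] (π : ∀ i, A →[L] M i) : A →[L] (∀ i, M i) where
  toFun a i := π i a
  map_fun' f x := funext fun i => (π i).map_fun f x
  map_rel' r x h := fun i => (π i).map_rel r x h

/-- Given a jointly injective family `π` and a homomorphism `f` that separates `b` from `b'`,
there is an ultrafilter along which `π` respects the kernel of `f` and still separates `b`
from `b'`. -/
theorem exists_ultrafilter {A B : Type u} [(opLanguage S).Structure A]
    [(opLanguage S).Structure B] {ι : Type u} {G : ι → Type u} [∀ i, CommGroup (G i)]
    (π : ∀ i, A →[opLanguage S] Ext (G i))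
    (hπ : ∀ x y, (∀ i, π i x = π i y) → x = y) (f : A →[opLanguage S] B) {b b' : A}
    (hb : f b ≠ f b') :
    ∃ U : Ultrafilter ι, (∀ x y, f x = f y → ∀ᶠ i in U, π i x = π i y) ∧
      ∀ᶠ i in U, π i b ≠ π i b' := by
  -- The sets `Z e` with `e ∈ N` form a filter base, as `Z (e * e') ⊆ Z e ∩ Z e'`.
  let N : Set A := {e | f e = f (unit S A) ∧ ∀ i, π i e = 1 ∨ π i e = .bot}
  let Z : A → Set ι := fun e => {i | π i e = 1 ∧ π i b ≠ π i b'}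
  have hone : unit S A ∈ N := ⟨rfl, fun i => .inl (map_unit (π i))⟩
  have hmul {e e' : A} (he : e ∈ N) (he' : e' ∈ N) : binOp (S := S) .mul e e' ∈ N := by
    constructor
    · rw [map_binOp, he.1, he'.1, ← map_binOp]
      congr 1
      refine hπ _ _ fun i => ?_
      rw [map_binOp, map_unit, Ext.binOp_mul, Ext.unit_eq, one_mul]
    · intro i
      rw [map_binOp, Ext.binOp_mul]
      rcases he.2 i with h | h <;> rcases he'.2 i with h' | h' <;>
        simp [h, h', Ext.bot_mul]
  have hZ {e e' : A} (he : e ∈ N) (he' : e' ∈ N) :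
      Z (binOp (S := S) .mul e e') ⊆ Z e ∩ Z e' := by
    rintro i ⟨hi, hbi⟩
    rw [map_binOp, Ext.binOp_mul] at hi
    rcases he.2 i with h | h <;> rcases he'.2 i with h' | h' <;> rw [h, h'] at hi
    · exact ⟨⟨h, hbi⟩, h', hbi⟩
    all_goals exact absurd (by simpa only [one_mul, Ext.bot_mul] using hi) Ext.bot_ne_one
  have hne {e : A} (he : e ∈ N) : (Z e).Nonempty := by
    -- Otherwise `e * b = e * b'`, and multiplying by `e` has no effect modulo the kernel of `f`.
    by_contra hemp
    rw [Set.not_nonempty_iff_eq_empty] at hemp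
    have heq : binOp (S := S) .mul e b = binOp (S := S) .mul e b' := by
      refine hπ _ _ fun i => ?_
      rw [map_binOp, map_binOp, Ext.binOp_mul, Ext.binOp_mul]
      rcases he.2 i with h | h
      · have : π i b = π i b' := by
          by_contra hbi
          exact (Set.eq_empty_iff_forall_notMem.1 hemp i) ⟨h, hbi⟩
        rw [this]
      · rw [h, Ext.bot_mul, Ext.bot_mul]
    have hunit (x : A) : f (binOp (S := S) .mul e x) = f x := by
      rw [map_binOp, he.1, ← map_binOp]
      congr 1
      refine hπ _ _ fun i => ?_
      rw [map_binOp, map_unit, Ext.binOp_mul, Ext.unit_eq, one_mul]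
    exact hb (by rw [← hunit b, heq, hunit])
  let F : Filter ι := ⨅ e : N, 𝓟 (Z e)
  have hF : F.NeBot := by
    have : Nonempty N := ⟨⟨_, hone⟩⟩
    refine iInf_neBot_of_directed' ?_ fun e => principal_neBot_iff.2 (hne e.2)
    rintro ⟨e, he⟩ ⟨e', he'⟩
    exact ⟨⟨_, hmul he he'⟩, principal_mono.2 ((hZ he he').trans Set.inter_subset_left),
      principal_mono.2 ((hZ he he').trans Set.inter_subset_right)⟩
  have hmem {e : A} (he : e ∈ N) : Z e ∈ Ultrafilter.of F :=
    Ultrafilter.of_le F (mem_iInf_of_mem (⟨e, he⟩ : N) (mem_principal_self _))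
  refine ⟨Ultrafilter.of F, fun x y hxy => ?_, ?_⟩
  · have he : eqv S x y ∈ N := by
      constructor
      · rw [map_eqv, hxy, ← map_eqv]
        congr 1
        refine hπ _ _ fun i => ?_
        rw [map_eqv, Ext.eqv_self, map_unit, Ext.unit_eq]
      · intro i
        rw [map_eqv, Ext.eqv_apply]
        split_ifs <;> simp
    filter_upwards [hmem he] with i hi
    by_contra hne
    exact Ext.bot_ne_one (by rw [← hi.1, map_eqv, Ext.eqv_of_ne hne])
  · filter_upwards [hmem hone] with i hi using hi.2

/-- Any two points of `A` are separated by a homomorphism into the algebra of a group without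
`p`-torsion for `p ∈ P`; equivalently, `A` embeds into a product of such algebras. -/
def Separated (P : Set ℕ) (S : Set OptSymbol) (A : Type u) [(opLanguage S).Structure A] : Prop :=
  ∀ a b : A, a ≠ b → ∃ (G : Type u) (_ : CommGroup G), NoTorsion P G ∧
    ∃ h : A →[opLanguage S] Ext G, h a ≠ h b

section Separated

variable {P : Set ℕ} {A B C : Type u} [(opLanguage S).Structure A] [(opLanguage S).Structure B]
  [(opLanguage S).Structure C]

theorem Separated.exists_family (hA : Separated P S A) :
    ∃ (ι : Type u) (G : ι → Type u) (_ : ∀ i, CommGroup (G i)),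
      (∀ i, NoTorsion P (G i)) ∧ ∃ π : ∀ i, A →[opLanguage S] Ext (G i),
        ∀ x y, (∀ i, π i x = π i y) → x = y := by
  choose G inst hG π hπ using fun i : {p : A × A // p.1 ≠ p.2} => hA i.1.1 i.1.2 i.2
  refine ⟨_, G, inst, hG, π, fun x y h => ?_⟩
  by_contra hne
  exact hπ ⟨(x, y), hne⟩ (h _)

/-- A weak form of congruence extension: if `f` separates two elements of a subalgebra of `C`,
some homomorphism from `C` into the algebra of a group separates them and respects the kernel
of `f`. -/
theorem Separated.exists_hom (hC : Separated P S C) (j : A →[opLanguage S] C)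
    (hj : Function.Injective j) (f : A →[opLanguage S] B) {b b' : A} (hb : f b ≠ f b') :
    ∃ (H : Type u) (_ : CommGroup H), NoTorsion P H ∧ ∃ g : C →[opLanguage S] Ext H,
      (∀ x y, f x = f y → g (j x) = g (j y)) ∧ g (j b) ≠ g (j b') := by
  obtain ⟨ι, G, inst, hG, π, hπ⟩ := hC.exists_family
  obtain ⟨U, hU, hUb⟩ := exists_ultrafilter (fun i => (π i).comp j)
    (fun x y h => hj (hπ _ _ h)) f hb
  refine ⟨GroupUltraproduct U G, inferInstance, noTorsion_groupUltraproduct U hG,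
    (limHom S U G).comp (piHom π),
    fun x y hxy => (limHom_eq_iff (S := S)).2 (hU x y hxy), fun h => ?_⟩
  exact Ultrafilter.eventually_not.1 hUb ((limHom_eq_iff (S := S)).1 h)

theorem Separated.of_injective (hB : Separated P S B) (i : A →[opLanguage S] B)
    (hi : Function.Injective i) : Separated P S A := by
  intro a b hab
  obtain ⟨G, inst, hG, h, hh⟩ := hB (i a) (i b) (hi.ne hab)
  exact ⟨G, inst, hG, h.comp i, hh⟩

theorem Separated.of_surjective (hA : Separated P S A) (f : A →[opLanguage S] B)
    (hf : Function.Surjective f) : Separated P S B := by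
  intro b b' hb
  obtain ⟨a, rfl⟩ := hf b
  obtain ⟨a', rfl⟩ := hf b'
  obtain ⟨H, inst, hH, g, hg, hne⟩ :=
    hA.exists_hom (FirstOrder.Language.Hom.id _ A) Function.injective_id f hb
  have hg' (x : A) : g (Function.surjInv hf (f x)) = g x :=
    hg _ _ (Function.surjInv_eq hf (f x))
  refine ⟨H, inst, hH, ⟨fun y => g (Function.surjInv hf y), ?_, fun r => Empty.elim r⟩, ?_⟩
  · intro n φ x
    have hx : x = f ∘ (Function.surjInv hf ∘ x) := funext fun k =>
      (Function.surjInv_eq hf (x k)).symm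
    calc g (Function.surjInv hf (Structure.funMap φ x))
        = g (Function.surjInv hf (f (Structure.funMap φ (Function.surjInv hf ∘ x)))) := by
          rw [f.map_fun, ← hx]
      _ = _ := by rw [hg', g.map_fun]; rfl
  · change g _ ≠ g _
    rw [hg', hg']
    exact hne

theorem separated_of_mem_products {A : Bundled.{u} (opLanguage S).Structure}
    (hA : A ∈ products (generators P S)) : Separated P S A := by
  obtain ⟨ι, M, hM, ⟨e⟩⟩ := hA
  intro a b hab
  obtain ⟨i, hi⟩ := Function.ne_iff.1 (e.injective.ne hab)
  rcases hM i with ⟨G, inst, hG, ⟨ε⟩⟩ | ⟨⟨_⟩⟩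
  · refine ⟨G, inst, hG, ε.toHom.comp (((⟨fun x => x i, fun _ _ => rfl, fun r => Empty.elim r⟩ :
      (∀ i, M i) →[opLanguage S] M i)).comp e.toHom), fun h => hi (ε.injective h)⟩
  · exact absurd (Subsingleton.elim _ _) hi

/-- The members of the variety are separated by homomorphisms into algebras of groups, as if it
were generated by forming products and subalgebras only. -/
theorem separated_of_mem_groupVariety {A : Bundled.{u} (opLanguage S).Structure}
    (hA : A ∈ groupVariety P S) : Separated P S A := by
  obtain ⟨B, ⟨D, hD, D', ⟨e⟩⟩, f, hf⟩ := hA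
  exact ((separated_of_mem_products hD).of_injective (D'.subtype.toHom.comp e.toHom)
    (D'.subtype.injective.comp e.injective)).of_surjective f hf

theorem pi_mem_groupVariety {ι : Type u} {G : ι → Type u} [∀ i, CommGroup (G i)]
    (hG : ∀ i, NoTorsion P (G i)) :
    (⟨∀ i, Ext (G i), inferInstance⟩ : Bundled.{u} (opLanguage S).Structure) ∈
      groupVariety P S := by
  refine ⟨⟨(⊤ : (opLanguage S).Substructure (∀ i, Ext (G i))), inferInstance⟩,
    ⟨⟨∀ i, Ext (G i), inferInstance⟩, ⟨ι, fun i => ⟨Ext (G i), inferInstance⟩, fun i => ?_,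
    ⟨FirstOrder.Language.Equiv.refl _ _⟩⟩, ⊤,
      ⟨FirstOrder.Language.Equiv.refl _ _⟩⟩,
    FirstOrder.Language.Substructure.topEquiv.toHom,
    FirstOrder.Language.Substructure.topEquiv.surjective⟩
  exact .inl ⟨G i, inferInstance, hG i, ⟨FirstOrder.Language.Equiv.refl _ _⟩⟩

end Separated

/-! ### Amalgamation of groups -/

section Groups

variable {P : Set ℕ}

/-- The elements some power of which, with exponent a product of members of `P`, lies in `T`. The
quotient by this subgroup has no `p`-torsion for `p ∈ P`; see `noTorsion_quotient_isolator`. -/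
def isolator (P : Set ℕ) {X : Type u} [CommGroup X] (T : Subgroup X) : Subgroup X where
  carrier := {x | ∃ n ∈ Submonoid.closure P, x ^ n ∈ T}
  one_mem' := ⟨1, one_mem _, by simp⟩
  mul_mem' := by
    rintro x y ⟨n, hn, hx⟩ ⟨m, hm, hy⟩
    refine ⟨n * m, mul_mem hn hm, ?_⟩
    rw [mul_pow, pow_mul, mul_comm n m, pow_mul]
    exact mul_mem (pow_mem hx m) (pow_mem hy n)
  inv_mem' := by
    rintro x ⟨n, hn, hx⟩
    exact ⟨n, hn, by simpa using hx⟩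

theorem le_isolator {X : Type u} [CommGroup X] (T : Subgroup X) : T ≤ isolator P T :=
  fun x hx => ⟨1, one_mem _, by simpa using hx⟩

theorem noTorsion_quotient_isolator {X : Type u} [CommGroup X] (T : Subgroup X) :
    NoTorsion P (X ⧸ isolator P T) := by
  intro p hp x
  induction x using QuotientGroup.induction_on with | _ x
  rw [← QuotientGroup.mk_pow, QuotientGroup.eq_one_iff, QuotientGroup.eq_one_iff]
  rintro ⟨n, hn, hx⟩
  exact ⟨p * n, mul_mem (Submonoid.subset_closure hp) hn, by rwa [pow_mul]⟩

theorem NoTorsion.eq_one_of_pow_eq_one {G : Type u} [CommGroup G] (hG : NoTorsion P G) {n : ℕ}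
    (hn : n ∈ Submonoid.closure P) {x : G} (hx : x ^ n = 1) : x = 1 := by
  induction hn using Submonoid.closure_induction generalizing x with
  | mem p hp => exact hG p hp x hx
  | one => simpa using hx
  | mul m n _ _ hm hn => exact hm (hn (by rwa [← pow_mul]))

variable {A G K : Type u} [(opLanguage S).Structure A] [CommGroup G] [CommGroup K]

/-- The pairs `(g, k⁻¹)` for which `g` and `k` are the values of `h` and `h'` at one and the same
element: the subgroup of `G × K` to be factored out to glue `G` and `K` along `A`. -/
def gluingSubgroup (h : A →[opLanguage S] Ext G) (h' : A →[opLanguage S] Ext K) :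
    Subgroup (G × K) where
  carrier := {x | ∃ a, h a = .of x.1 ∧ h' a = .of x.2⁻¹}
  one_mem' := ⟨unit S A, map_unit h, by rw [map_unit]; exact congrArg Ext.of inv_one.symm⟩
  mul_mem' := by
    rintro x y ⟨a, ha, ha'⟩ ⟨b, hb, hb'⟩
    refine ⟨binOp (S := S) .mul a b, ?_, ?_⟩
    · rw [map_binOp, ha, hb]
      rfl
    · rw [map_binOp, ha', hb', Prod.snd_mul, mul_inv]
      rfl
  inv_mem' := by
    rintro x ⟨a, ha, ha'⟩
    refine ⟨binOp (S := S) .imp a (unit S A), ?_, ?_⟩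
    · rw [map_binOp, map_unit, ha]
      exact congrArg Ext.of (by simp)
    · rw [map_binOp, map_unit, ha']
      exact congrArg Ext.of (by simp)

/-- Two homomorphisms on `A` into algebras of groups that have the same kernel and are not constant
become equal after an embedding of the groups into a common group. -/
theorem exists_group_amalgam (hG : NoTorsion P G) (hK : NoTorsion P K)
    (h : A →[opLanguage S] Ext G) (h' : A →[opLanguage S] Ext K)
    (hker : ∀ x y, h x = h y ↔ h' x = h' y) {a₀ : A} (ha₀ : h a₀ ≠ 1) :
    ∃ (H : Type u) (_ : CommGroup H), NoTorsion P H ∧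
      ∃ (φ : G →* H) (ψ : K →* H), Function.Injective φ ∧ Function.Injective ψ ∧
        ∀ a, (h a).map φ = (h' a).map ψ := by
  let T := gluingSubgroup h h'
  have hunit : h (unit S A) = 1 := map_unit h
  have hunit' : h' (unit S A) = 1 := map_unit h'
  refine ⟨(G × K) ⧸ isolator P T, inferInstance, noTorsion_quotient_isolator T,
    (QuotientGroup.mk' _).comp (MonoidHom.inl G K),
    (QuotientGroup.mk' _).comp (MonoidHom.inr G K), ?_, ?_, ?_⟩
  · refine (injective_iff_map_eq_one _).2 fun g hg => ?_
    obtain ⟨n, hn, a, ha, ha'⟩ := (QuotientGroup.eq_one_iff _).1 hg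
    refine hG.eq_one_of_pow_eq_one hn ?_
    have h1 : h a = h (unit S A) := by
      rw [hker, ha', hunit']
      exact congrArg Ext.of (by simp)
    rw [h1, hunit] at ha
    exact (Ext.of.inj ha).symm
  · refine (injective_iff_map_eq_one _).2 fun k hk => ?_
    obtain ⟨n, hn, a, ha, ha'⟩ := (QuotientGroup.eq_one_iff _).1 hk
    refine hK.eq_one_of_pow_eq_one hn ?_
    have h1 : h' a = h' (unit S A) := by
      rw [← hker, ha, hunit]
      exact congrArg Ext.of (by simp)
    rw [h1, hunit'] at ha'
    exact inv_eq_one.1 (Ext.of.inj ha').symm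
  · -- Elements of `A` with value `⊥` or `⊤` under both homomorphisms; since neither constant
    -- need be in the signature, they come from the element on which `h` differs from `1`.
    let z := eqv S a₀ (unit S A)
    let t := binOp (S := S) .imp z z
    have ha₀' : h' a₀ ≠ 1 := by rwa [← hunit', ne_eq, ← hker, hunit]
    have hz : h z = .bot := by rw [map_eqv, hunit, Ext.eqv_of_ne ha₀]
    have hz' : h' z = .bot := by rw [map_eqv, hunit', Ext.eqv_of_ne ha₀']
    have ht : h t = .top := by rw [map_binOp, hz]; rfl
    have ht' : h' t = .top := by rw [map_binOp, hz']; rfl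
    intro a
    have hbot := hker a z
    have htop := hker a t
    rw [hz, hz'] at hbot
    rw [ht, ht'] at htop
    cases hg : h a with
    | bot => rw [hbot.1 hg]; rfl
    | top => rw [htop.1 hg]; rfl
    | of g =>
      cases hk : h' a with
      | bot => rw [hbot.2 hk] at hg; cases hg
      | top => rw [htop.2 hk] at hg; cases hg
      | of k =>
        refine congrArg Ext.of (QuotientGroup.eq.2 (le_isolator T ?_))
        refine ⟨binOp (S := S) .imp a (unit S A), ?_, ?_⟩
        · rw [map_binOp, map_unit, hg]
          exact congrArg Ext.of (by simp)
        · rw [map_binOp, map_unit, hk]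
          exact congrArg Ext.of (by simp)

end Groups

/-! ### Amalgamation in the variety -/

section Amalgamation

variable {P : Set ℕ} {A B C : Type u} [(opLanguage S).Structure A] [(opLanguage S).Structure B]
  [(opLanguage S).Structure C]

/-- Two points of `B` are separated by a homomorphism into the algebra of a group whose restriction
to the common subalgebra `A` of `B` and `C` also extends to `C`. -/
theorem exists_compatible_homs (hB : Separated P S B) (hC : Separated P S C)
    (i : A →[opLanguage S] B) (j : A →[opLanguage S] C) (hj : Function.Injective j) {b b' : B}
    (hb : b ≠ b') :
    ∃ (H : Type u) (_ : CommGroup H), NoTorsion P H ∧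
      ∃ (f : B →[opLanguage S] Ext H) (g : C →[opLanguage S] Ext H),
        (∀ a, f (i a) = g (j a)) ∧ f b ≠ f b' := by
  obtain ⟨G, _, hG, f, hf⟩ := hB b b' hb
  by_cases hconst : ∀ a, f (i a) = 1
  · -- A constant restriction excludes `⊥` and `⊤` from the signature, so it extends as a constant.
    have hbot : OptSymbol.bot ∉ S := by
      intro hS
      have h := (f.comp i).map_fun (OpSymbol.bot hS : (opLanguage S).Functions 0) ![]
      exact Ext.bot_ne_one (h.symm.trans (hconst _))
    have htop : OptSymbol.top ∉ S := by
      intro hS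
      have h := (f.comp i).map_fun (OpSymbol.top hS : (opLanguage S).Functions 0) ![]
      exact Ext.top_ne_one (h.symm.trans (hconst _))
    exact ⟨G, inferInstance, hG, f, Ext.constHom hbot htop, hconst, hf⟩
  · push Not at hconst
    obtain ⟨a₀, ha₀⟩ := hconst
    let h := f.comp i
    have hunit : h (unit S A) = 1 := map_unit h
    have ha₀' : h a₀ ≠ h (unit S A) := by rwa [hunit]
    obtain ⟨K, _, hK, g, hg, hg₀⟩ := hC.exists_hom j hj h ha₀'
    let k := g.comp j
    have hk₀ : k a₀ ≠ k (unit S A) := hg₀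
    -- The image of `h` is simple: as `a₀` and `1` stay distinct under `k`, so do all elements that
    -- `h` separates, since `h` sends `eqv x y` and `eqv a₀ 1` both to `⊥`.
    have hker (x y : A) : h x = h y ↔ k x = k y := by
      refine ⟨hg x y, fun hk => ?_⟩
      by_contra hxy
      have h1 : k (eqv S x y) = k (eqv S a₀ (unit S A)) := hg _ _ <| by
        rw [map_eqv, map_eqv, Ext.eqv_of_ne hxy, Ext.eqv_of_ne ha₀']
      rw [map_eqv, map_eqv, hk, Ext.eqv_self, Ext.eqv_of_ne hk₀] at h1
      exact Ext.bot_ne_one h1.symm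
    obtain ⟨H, _, hH, φ, ψ, hφ, hψ, hcomm⟩ := exists_group_amalgam hG hK h k hker ha₀
    exact ⟨H, inferInstance, hH, (Ext.mapHom S φ hφ).comp f, (Ext.mapHom S ψ hψ).comp g, hcomm,
      (Ext.map_injective hφ).ne hf⟩

/-- An injective homomorphism is an embedding, as the language has no relation symbols. -/
def embeddingOfInjective (f : A →[opLanguage S] B) (hf : Function.Injective f) :
    A ↪[opLanguage S] B where
  toFun := f
  inj' := hf
  map_fun' := f.map_fun
  map_rel' := fun r => Empty.elim r

theorem amalgamation_groupVariety (P : Set ℕ) (S : Set OptSymbol) :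
    FirstOrder.Language.Amalgamation (groupVariety.{u} P S) := by
  intro A B C i j _ hB hC
  have sB := separated_of_mem_groupVariety hB
  have sC := separated_of_mem_groupVariety hC
  -- The amalgam is a product with one factor for each pair of points to be separated.
  have hpair (q : {p : B × B // p.1 ≠ p.2} ⊕ {p : C × C // p.1 ≠ p.2}) :
      ∃ (H : Type u) (_ : CommGroup H), NoTorsion P H ∧
        ∃ (f : B →[opLanguage S] Ext H) (g : C →[opLanguage S] Ext H),
          (∀ a, f (i a) = g (j a)) ∧
            q.elim (fun p => f p.1.1 ≠ f p.1.2) (fun p => g p.1.1 ≠ g p.1.2) := by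
    rcases q with p | p
    · exact exists_compatible_homs sB sC i.toHom j.toHom j.injective p.2
    · obtain ⟨H, inst, hH, g, f, hfg, hg⟩ :=
        exists_compatible_homs sC sB j.toHom i.toHom i.injective p.2
      exact ⟨H, inst, hH, f, g, fun a => (hfg a).symm, hg⟩
  choose H inst hH f g hfg hsep using hpair
  refine ⟨⟨∀ q, Ext (H q), inferInstance⟩, embeddingOfInjective (piHom f) ?_,
    embeddingOfInjective (piHom g) ?_, pi_mem_groupVariety hH, ?_⟩
  · intro x y hxy
    by_contra hne
    exact hsep (.inl ⟨(x, y), hne⟩) (congrFun hxy _)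
  · intro x y hxy
    by_contra hne
    exact hsep (.inr ⟨(x, y), hne⟩) (congrFun hxy _)
  · ext a q
    exact hfg q a

end Amalgamation

end ResiduatedAmalgamation

theorem theorem3p7 (P : Set ℕ) (hP : ∀ p ∈ P, p.Prime) (hne : P.Nonempty)
    (S : Set ResiduatedAmalgamation.OptSymbol) :
    FirstOrder.Language.Amalgamation (ResiduatedAmalgamation.groupVariety.{u} P S) :=
  ResiduatedAmalgamation.amalgamation_groupVariety P S
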